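/- A continuum is a non-empty compact connected metrizable space. A collection $\mathcal C$ of continua is called uniquely compactifiable if there exists a compact metrizable space $X$ such that for every $C\in\mathcal C$ there exists a unique connected component $D$ of $X$ that is homeomorphic to $C$. The collection of all continua is not uniquely compactifiable; that is, there is no compact metrizable space $X$ such that every continuum is homeomorphic to exactly one connected component of $X$. -/

import Mathlib

universe u v

/-- A continuum: a compact connected metrizable space. `ConnectedSpace` includes non-emptiness;
a one-point space is a continuum. -/
def IsContinuum (C : Type*) [TopologicalSpace C] : Prop :=
  CompactSpace C ∧ ConnectedSpace C ∧ TopologicalSpace.MetrizableSpace C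

/-- `D` is a (connected) component of the space `X`. -/
def IsComponent {X : Type*} [TopologicalSpace X] (D : Set X) : Prop :=
  ∃ x : X, D = connectedComponent x

/-- A collection `𝒞` of spaces is uniquely compactifiable if there is a compact metrizable space
`X` such that for every `C` in `𝒞` there is exactly one component `D` of `X` homeomorphic to `C`. -/
def UniquelyCompactifiable (𝒞 : ∀ C : Type v, TopologicalSpace C → Prop) : Prop :=
  ∃ (X : Type u) (_ : TopologicalSpace X),
    CompactSpace X ∧ TopologicalSpace.MetrizableSpace X ∧
      ∀ (C : Type v) (tC : TopologicalSpace C), 𝒞 C tC →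
        ∃! D : Set X, IsComponent D ∧ Nonempty (C ≃ₜ D)

open Set Filter Topology MeasureTheory TopologicalSpace

/-! The obstruction is a Baire category zero-one law. To each two-sided binary sequence `x` attach a
plane continuum, a comb: an interval with points accumulating only at its ends in order type `ℤ`,
each bearing an upper arc, and a lower arc at the `n`th point exactly when `x n` is true. Shifting
`x` does not change the homeomorphism type. Conversely the upper arcs make the marked points the
only branch points, a homeomorphism preserves their betweenness, and lower arcs are read off from
orders of points; so each homeomorphism class of sequences is countable.

If `X` contained each comb as exactly one component `D x`, then for clopen `U` both `D x ⊆ U` and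
its negation `D x ⊆ Uᶜ` would be analytic conditions on `x`
(`analyticSet_setOf_homeomorph_component`), hence Borel by Suslin's theorem. They are shift
invariant, and the shift is topologically transitive, so each is decided on a comeagre set. As `X`
has only countably many clopen sets and they separate components, `D` is constant on a comeagre set.
Comeagrely many combs are then homeomorphic to one another, yet a countable class is meagre. -/

/-! ### Components and clopen sets of compact spaces -/

theorem isClosed_setOf_mem_connectedComponent {X : Type*} [TopologicalSpace X] [CompactSpace X]
    [T2Space X] : IsClosed {p : X × X | p.2 ∈ connectedComponent p.1} := by
  have h : {p : X × X | p.2 ∈ connectedComponent p.1} =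
      {p | (p.2 : ConnectedComponents X) = (p.1 : ConnectedComponents X)} := by
    ext p
    exact ConnectedComponents.coe_eq_coe'.symm
  rw [h]
  -- The quotient by components is Hausdorff because `X` is compact Hausdorff.
  exact isClosed_eq (ConnectedComponents.continuous_coe.comp continuous_snd)
    (ConnectedComponents.continuous_coe.comp continuous_fst)

theorem isClosed_setOf_exists_of_compactSpace {A K : Type*} [TopologicalSpace A]
    [TopologicalSpace K] [CompactSpace K] {P : A → K → Prop}
    (h : IsClosed {p : A × K | P p.1 p.2}) : IsClosed {a | ∃ k, P a k} := by
  have := isClosedMap_fst_of_compactSpace _ h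
  convert this using 1
  ext a
  simp

/-- A clopen set is compact, hence a finite union of members of a countable basis. -/
theorem countable_clopens_of_compactSpace {X : Type*} [TopologicalSpace X] [CompactSpace X]
    [SecondCountableTopology X] : Countable (Clopens X) := by
  have : ∀ (s : Clopens X), ∃ (t : Finset (countableBasis X)),
      s.1 = ⋃₀ (Subtype.val '' (t : Set (countableBasis X))) := by
    intro s
    obtain ⟨t, ht, hs⟩ := eq_finite_iUnion_of_isTopologicalBasis_of_isCompact_open
      (fun b : countableBasis X => (b : Set X))
      (by rw [Subtype.range_coe]; exact isBasis_countableBasis X) s.1 s.2.isClosed.isCompact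
      s.2.isOpen
    exact ⟨ht.toFinset, by rw [hs]; simp [sUnion_image]⟩
  choose f hf using this
  exact Function.Injective.countable (f := f) fun s t h =>
    Clopens.ext ((hf s).trans ((congrArg (fun u : Finset (countableBasis X) =>
      ⋃₀ (Subtype.val '' (u : Set (countableBasis X)))) h).trans (hf t).symm))

/-! ### Descriptive complexity of embeddings onto components -/

section Family

variable {Ω K X : Type*} [TopologicalSpace Ω] [MetricSpace K] [CompactSpace K]
  [MetricSpace X] {F : Ω → Set K}

theorem measurableSet_setOf_injOn [MeasurableSpace (Ω × C(K, X))] [BorelSpace (Ω × C(K, X))]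
    (hF : IsClosed {p : Ω × K | p.2 ∈ F p.1}) :
    MeasurableSet {p : Ω × C(K, X) | InjOn p.2 (F p.1)} := by
  -- Keeping the two points at distance at least `1 / (n + 1)` makes each failure condition closed,
  -- so the complement is an Fσ set.
  have key : {p : Ω × C(K, X) | InjOn p.2 (F p.1)}ᶜ = ⋃ n : ℕ, {p : Ω × C(K, X) | ∃ k : K × K,
      k.1 ∈ F p.1 ∧ k.2 ∈ F p.1 ∧ 1 / ((n : ℝ) + 1) ≤ dist k.1 k.2 ∧ p.2 k.1 = p.2 k.2} := by
    ext p
    simp only [mem_compl_iff, mem_ofPred_eq, InjOn, mem_iUnion]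
    push Not
    constructor
    · rintro ⟨k, hk, l, hl, h, hne⟩
      obtain ⟨n, hn⟩ := exists_nat_one_div_lt (dist_pos.2 hne)
      exact ⟨n, (k, l), hk, hl, hn.le, h⟩
    · rintro ⟨n, ⟨k, l⟩, hk, hl, hn, h⟩
      exact ⟨k, hk, l, hl, h, dist_pos.1 (lt_of_lt_of_le (by positivity) hn)⟩
  refine MeasurableSet.of_compl ?_
  rw [key]
  refine MeasurableSet.iUnion fun n => IsClosed.measurableSet ?_
  refine isClosed_setOf_exists_of_compactSpace ?_
  refine IsClosed.inter (hF.preimage (f := fun q : (Ω × C(K, X)) × (K × K) => (q.1.1, q.2.1))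
    (by fun_prop)) (IsClosed.inter (hF.preimage
    (f := fun q : (Ω × C(K, X)) × (K × K) => (q.1.1, q.2.2)) (by fun_prop))
    (IsClosed.inter (isClosed_le (f := fun _ => 1 / ((n : ℝ) + 1))
      (g := fun q : (Ω × C(K, X)) × (K × K) => dist q.2.1 q.2.2) (by fun_prop) (by fun_prop))
      (isClosed_eq (f := fun q : (Ω × C(K, X)) × (K × K) => q.1.2 q.2.1) (g := fun q => q.1.2 q.2.2)
      (by fun_prop) (by fun_prop))))

theorem isOpen_setOf_mapsTo (hF : IsClosed {p : Ω × K | p.2 ∈ F p.1}) {U : Set X}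
    (hU : IsOpen U) : IsOpen {p : Ω × C(K, X) | MapsTo p.2 (F p.1) U} := by
  have key : {p : Ω × C(K, X) | MapsTo p.2 (F p.1) U}ᶜ =
      {p | ∃ k : K, k ∈ F p.1 ∧ p.2 k ∈ Uᶜ} := by
    ext p
    simp only [mem_compl_iff, mem_ofPred_eq, MapsTo]
    push Not
    rfl
  rw [← isClosed_compl_iff, key]
  refine isClosed_setOf_exists_of_compactSpace ?_
  exact IsClosed.inter (hF.preimage (f := fun q : (Ω × C(K, X)) × K => (q.1.1, q.2))
    (by fun_prop)) (hU.isClosed_compl.preimage (f := fun q : (Ω × C(K, X)) × K => q.1.2 q.2)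
    (by fun_prop))

theorem measurableSet_setOf_connectedComponent_subset_image [CompactSpace X]
    [MeasurableSpace (Ω × C(K, X))] [BorelSpace (Ω × C(K, X))]
    (hF : IsClosed {p : Ω × K | p.2 ∈ F p.1}) (hO : ∀ k, IsOpen {ω | k ∈ F ω}) (k₀ : K) :
    MeasurableSet {p : Ω × C(K, X) | connectedComponent (p.2 k₀) ⊆ p.2 '' F p.1} := by
  -- The image is closed, so a missed point stays a definite distance away. Openness `hO` then makes
  -- the quantifier over `k ∈ F ω` a closed condition.
  have key : {p : Ω × C(K, X) | connectedComponent (p.2 k₀) ⊆ p.2 '' F p.1}ᶜ =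
      ⋃ n : ℕ, {p : Ω × C(K, X) | ∃ y : X, y ∈ connectedComponent (p.2 k₀) ∧
        ∀ k : K, k ∈ F p.1 → 1 / ((n : ℝ) + 1) ≤ dist (p.2 k) y} := by
    ext p
    simp only [mem_compl_iff, mem_ofPred_eq, not_subset, mem_iUnion]
    constructor
    · rintro ⟨y, hy, hn⟩
      have hc : IsClosed (p.2 '' F p.1) :=
        ((hF.preimage (f := fun k : K => (p.1, k)) (by fun_prop)).isCompact.image
          p.2.continuous).isClosed
      obtain ⟨ε, hε, hb⟩ := Metric.isOpen_iff.1 hc.isOpen_compl y hn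
      obtain ⟨n, hn⟩ := exists_nat_one_div_lt hε
      refine ⟨n, y, hy, fun k hk => ?_⟩
      by_contra! hlt
      exact hb (Metric.mem_ball.2 (hlt.trans hn)) (mem_image_of_mem _ hk)
    · rintro ⟨n, y, hy, h⟩
      refine ⟨y, hy, ?_⟩
      rintro ⟨k, hk, rfl⟩
      have := h k hk
      rw [dist_self] at this
      exact absurd this (not_le.2 (by positivity))
  refine MeasurableSet.of_compl ?_
  rw [key]
  refine MeasurableSet.iUnion fun n => IsClosed.measurableSet ?_
  refine isClosed_setOf_exists_of_compactSpace ?_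
  refine IsClosed.inter (isClosed_setOf_mem_connectedComponent.preimage
    (f := fun q : (Ω × C(K, X)) × X => (q.1.2 k₀, q.2)) (by fun_prop)) ?_
  have : {q : (Ω × C(K, X)) × X | ∀ k : K, k ∈ F q.1.1 → 1 / ((n : ℝ) + 1) ≤ dist (q.1.2 k) q.2} =
      ⋂ k : K, ({q | k ∈ F q.1.1}ᶜ ∪ {q | 1 / ((n : ℝ) + 1) ≤ dist (q.1.2 k) q.2}) := by
    ext q
    simp [imp_iff_not_or]
  change IsClosed {q : (Ω × C(K, X)) × X |
    ∀ k : K, k ∈ F q.1.1 → 1 / ((n : ℝ) + 1) ≤ dist (q.1.2 k) q.2}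
  rw [this]
  refine isClosed_iInter fun k => IsClosed.union ?_ (isClosed_le (by fun_prop) (by fun_prop))
  exact ((hO k).preimage (f := fun q : (Ω × C(K, X)) × X => q.1.1) (by fun_prop)).isClosed_compl

/-- The parameters for which the corresponding member of a family of subcontinua of `K` is
homeomorphic to a component of `X` lying in `U` form an analytic set. -/
theorem analyticSet_setOf_homeomorph_component [PolishSpace Ω] [CompactSpace X]
    (hF : IsClosed {p : Ω × K | p.2 ∈ F p.1}) (hO : ∀ k, IsOpen {ω | k ∈ F ω})
    (hconn : ∀ ω, IsPreconnected (F ω)) {k₀ : K} (hk₀ : ∀ ω, k₀ ∈ F ω)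
    (hr : ∀ ω, ∃ r : C(K, F ω), ∀ k : F ω, r k = k) {U : Set X} (hU : IsOpen U) :
    AnalyticSet {ω | ∃ D : Set X, IsComponent D ∧ Nonempty (F ω ≃ₜ D) ∧ D ⊆ U} := by
  borelize (Ω × C(K, X))
  have hE : MeasurableSet ({p : Ω × C(K, X) | InjOn p.2 (F p.1)} ∩
      {p : Ω × C(K, X) | MapsTo p.2 (F p.1) U} ∩
      {p : Ω × C(K, X) | connectedComponent (p.2 k₀) ⊆ p.2 '' F p.1}) :=
    ((measurableSet_setOf_injOn hF).inter (isOpen_setOf_mapsTo hF hU).measurableSet).inter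
      (measurableSet_setOf_connectedComponent_subset_image hF hO k₀)
  convert hE.analyticSet.image_of_continuous (continuous_fst (X := Ω) (Y := C(K, X))) using 1
  ext ω
  simp only [mem_ofPred_eq, mem_image, mem_inter_iff, Prod.exists, exists_and_right,
    exists_eq_right]
  constructor
  · rintro ⟨D, ⟨x, rfl⟩, ⟨h⟩, hDU⟩
    -- The retraction extends the embedding of `F ω` to all of `K`, so that all embeddings live in
    -- the one Polish space `C(K, X)`.
    obtain ⟨r, hr⟩ := hr ω
    let g : C(K, X) := ⟨fun k => h (r k), by fun_prop⟩
    have hg : ∀ k (hk : k ∈ F ω), g k = h ⟨k, hk⟩ := fun k hk =>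
      congrArg (fun z => (h z : X)) (hr ⟨k, hk⟩)
    refine ⟨g, ⟨fun k hk l hl hkl => ?_, fun k hk => hDU (h (r k)).2⟩, fun y hy => ?_⟩
    · rw [hg k hk, hg l hl] at hkl
      exact congrArg Subtype.val (h.injective (Subtype.ext hkl))
    · have h₀ : connectedComponent (g k₀) = connectedComponent x :=
        (connectedComponent_eq (h (r k₀)).2).symm
      rw [h₀] at hy
      refine ⟨(h.symm ⟨y, hy⟩ : F ω), (h.symm ⟨y, hy⟩).2, ?_⟩
      refine (hg _ (h.symm ⟨y, hy⟩).2).trans ?_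
      simp
  · rintro ⟨g, ⟨hinj, hmaps⟩, hsub⟩
    have himg : g '' F ω = connectedComponent (g k₀) :=
      (((hconn ω).image g g.continuous.continuousOn).subset_connectedComponent
        (mem_image_of_mem g (hk₀ ω))).antisymm hsub
    have hc : CompactSpace (F ω) := isCompact_iff_compactSpace.1
      (hF.preimage (f := fun k : K => (ω, k)) (by fun_prop)).isCompact
    have hemb : IsEmbedding (fun k : F ω => g k) :=
      (Continuous.isClosedEmbedding (g.continuous.comp continuous_subtype_val)
        (injOn_iff_injective.1 hinj)).isEmbedding
    refine ⟨g '' F ω, ⟨g k₀, himg⟩, ⟨?_⟩, hmaps.image_subset⟩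
    refine hemb.toHomeomorph.trans (Homeomorph.setCongr ?_)
    rw [image_eq_range]

end Family

/-! ### The zero-one law and the abstract contradiction -/

/-- A Baire measurable set invariant under a topologically transitive homeomorphism is meagre or
residual. -/
theorem BaireMeasurableSet.mem_residual_or_compl_of_invariant {Ω : Type*} [TopologicalSpace Ω]
    [BaireSpace Ω] (T : Ω ≃ₜ Ω)
    (hT : ∀ U V : Set Ω, IsOpen U → IsOpen V → U.Nonempty → V.Nonempty →
      ∃ n : ℕ, (T^[n] ⁻¹' U ∩ V).Nonempty)
    {A : Set Ω} (hA : BaireMeasurableSet A) (hinv : T ⁻¹' A = A) :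
    A ∈ residual Ω ∨ Aᶜ ∈ residual Ω := by
  have hit : ∀ n : ℕ, T^[n] ⁻¹' A = A := by
    intro n
    induction n with
    | zero => rfl
    | succ n ih => rw [Function.iterate_succ, preimage_comp, ih, hinv]
  have hopen : ∀ n : ℕ, IsOpenMap T^[n] := by
    intro n
    induction n with
    | zero => exact IsOpenMap.id
    | succ n ih => rw [Function.iterate_succ]; exact ih.comp T.isOpenMap
  obtain ⟨U, hU, hAU⟩ := hA.residualEq_isOpen
  obtain ⟨V, hV, hAV⟩ := hA.compl.residualEq_isOpen
  rw [eventuallyEq_set] at hAU hAV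
  -- Otherwise some `T^[n] ⁻¹' U ∩ V` is a nonempty open set, almost all of whose points lie both in
  -- `A` and in its complement.
  have hempty : ¬ (U.Nonempty ∧ V.Nonempty) := by
    rintro ⟨hU', hV'⟩
    obtain ⟨n, hn⟩ := hT U V hU hV hU' hV'
    have hcont : Continuous T^[n] := T.continuous.iterate n
    have h1 := (tendsto_residual_of_isOpenMap hcont (hopen n)).eventually hAU
    have hres : {x | x ∉ T^[n] ⁻¹' U ∩ V} ∈ residual Ω := by
      filter_upwards [h1, hAV] with x hx hxV hmem
      have h2 : x ∈ A := by
        rw [← hit n]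
        exact hx.2 hmem.1
      exact hxV.2 hmem.2 h2
    obtain ⟨x, hx, hx'⟩ := (dense_of_mem_residual hres).inter_open_nonempty _
      ((hU.preimage hcont).inter hV) hn
    exact hx' hx
  rcases U.eq_empty_or_nonempty with rfl | hU'
  · right
    filter_upwards [hAU] with x hx
    exact fun h => hx.1 h
  · left
    have hVe : V = ∅ := by
      by_contra h
      exact hempty ⟨hU', nonempty_iff_ne_empty.2 h⟩
    subst hVe
    filter_upwards [hAV] with x hx
    by_contra h
    exact hx.1 h

/-- A family of subcontinua of `K`, invariant under a transitive homeomorphism of its parameter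
space and with countable homeomorphism classes, is not uniquely compactifiable. -/
theorem not_forall_existsUnique_component {Ω K X : Type*} [TopologicalSpace Ω] [PolishSpace Ω]
    [PerfectSpace Ω] [Nonempty Ω] [MetricSpace K] [CompactSpace K] [MetricSpace X] [CompactSpace X]
    {F : Ω → Set K}
    (hF : IsClosed {p : Ω × K | p.2 ∈ F p.1}) (hO : ∀ k, IsOpen {ω | k ∈ F ω})
    (hconn : ∀ ω, IsPreconnected (F ω)) {k₀ : K} (hk₀ : ∀ ω, k₀ ∈ F ω)
    (hr : ∀ ω, ∃ r : C(K, F ω), ∀ k : F ω, r k = k) (T : Ω ≃ₜ Ω)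
    (hT : ∀ U V : Set Ω, IsOpen U → IsOpen V → U.Nonempty → V.Nonempty →
      ∃ n : ℕ, (T^[n] ⁻¹' U ∩ V).Nonempty)
    (hTF : ∀ ω, Nonempty (F (T ω) ≃ₜ F ω))
    (hcount : ∀ ω, {ω' | Nonempty (F ω ≃ₜ F ω')}.Countable) :
    ¬ ∀ ω, ∃! D : Set X, IsComponent D ∧ Nonempty (F ω ≃ₜ D) := by
  intro hX
  choose D hD huniq using hX
  borelize Ω
  have hset : ∀ U : Set X, {ω | ∃ D : Set X, IsComponent D ∧ Nonempty (F ω ≃ₜ D) ∧ D ⊆ U} =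
      {ω | D ω ⊆ U} := by
    intro U
    ext ω
    constructor
    · rintro ⟨D', h1, h2, h3⟩
      rwa [mem_ofPred_eq, ← huniq ω D' ⟨h1, h2⟩]
    · intro h
      exact ⟨D ω, (hD ω).1, (hD ω).2, h⟩
  have hcompl : ∀ U : Set X, IsClopen U → {ω | D ω ⊆ U}ᶜ = {ω | D ω ⊆ Uᶜ} := by
    intro U hU
    ext ω
    obtain ⟨⟨x, hx⟩, -⟩ := hD ω
    have hpre : IsPreconnected (D ω) := hx ▸ isPreconnected_connectedComponent
    have hmem : x ∈ D ω := hx ▸ mem_connectedComponent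
    simp only [mem_compl_iff, mem_ofPred_eq]
    constructor
    · intro h
      by_cases hxU : x ∈ U
      · exact absurd (hpre.subset_isClopen hU ⟨x, hmem, hxU⟩) h
      · exact hpre.subset_isClopen hU.compl ⟨x, hmem, hxU⟩
    · intro h h'
      exact h hmem (h' hmem)
  -- Suslin's theorem: the set and its complement are both analytic.
  have hmeas : ∀ U : Set X, IsClopen U → MeasurableSet {ω | D ω ⊆ U} := by
    intro U hU
    refine AnalyticSet.measurableSet_of_compl ?_ ?_
    · rw [← hset]
      exact analyticSet_setOf_homeomorph_component hF hO hconn hk₀ hr hU.isOpen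
    · rw [hcompl U hU, ← hset]
      exact analyticSet_setOf_homeomorph_component hF hO hconn hk₀ hr hU.compl.isOpen
  have hDT : ∀ ω, D (T ω) = D ω := by
    intro ω
    refine huniq ω _ ⟨(hD _).1, ?_⟩
    obtain ⟨e⟩ := hTF ω
    obtain ⟨e'⟩ := (hD (T ω)).2
    exact ⟨e.symm.trans e'⟩
  have hzo : ∀ U : Clopens X, ∃ P : Prop, ∀ᶠ ω in residual Ω, (D ω ⊆ U ↔ P) := by
    intro U
    rcases (hmeas U U.2).baireMeasurableSet.mem_residual_or_compl_of_invariant T hT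
      (by ext ω; simp [hDT]) with h | h
    · exact ⟨True, by filter_upwards [h] with ω hω; simpa using hω⟩
    · exact ⟨False, by filter_upwards [h] with ω hω; simpa using hω⟩
  choose P hP using hzo
  have := countable_clopens_of_compactSpace (X := X)
  have hall : ∀ᶠ ω in residual Ω, ∀ U : Clopens X, (D ω ⊆ U ↔ P U) :=
    eventually_countable_forall.2 hP
  obtain ⟨ω₀, hω₀⟩ := (dense_of_mem_residual hall).nonempty
  have hEq : ∀ᶠ ω in residual Ω, D ω = D ω₀ := by
    filter_upwards [hall] with ω hω
    obtain ⟨⟨x, hx⟩, -⟩ := hD ω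
    obtain ⟨⟨y, hy⟩, -⟩ := hD ω₀
    -- In a compact Hausdorff space components are quasi-components, so the clopen sets around a
    -- component determine it.
    have hxy : x ∈ connectedComponent y := by
      rw [connectedComponent_eq_iInter_isClopen, mem_iInter]
      rintro ⟨U, hU, hyU⟩
      have h1 : D ω₀ ⊆ U := hy ▸ hU.connectedComponent_subset hyU
      have h2 : D ω ⊆ U := (hω ⟨U, hU⟩).2 ((hω₀ ⟨U, hU⟩).1 h1)
      exact h2 (hx ▸ mem_connectedComponent)
    rw [hx, hy, connectedComponent_eq hxy]
  -- Points are nowhere dense in a perfect space, so countable sets are meagre.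
  have hnot : ∀ᶠ ω in residual Ω, ω ∉ {ω' | Nonempty (F ω₀ ≃ₜ F ω')} := by
    have h1 : ∀ a ∈ {ω' | Nonempty (F ω₀ ≃ₜ F ω')}, ∀ᶠ ω in residual Ω, ω ≠ a := fun a _ =>
      residual_of_dense_open isOpen_compl_singleton (dense_compl_singleton a)
    filter_upwards [(eventually_countable_ball (hcount ω₀)).2 h1] with ω hω hmem
    exact hω ω hmem rfl
  obtain ⟨ω, h1, h2⟩ := (dense_of_mem_residual (hEq.and hnot)).nonempty
  obtain ⟨e⟩ := (hD ω₀).2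
  obtain ⟨e'⟩ := (hD ω).2
  exact h2 ⟨e.trans ((Homeomorph.setCongr h1.symm).trans e'.symm)⟩

/-! ### Combs in the plane -/

/-- A sequence of points of `(0, 1)` of order type `ℤ`, converging to `0` and `1`. -/
noncomputable def combPoint (n : ℤ) : ℝ := 2 ^ n / (1 + 2 ^ n)

theorem combPoint_pos (n : ℤ) : 0 < combPoint n := by
  unfold combPoint
  positivity

theorem combPoint_lt_one (n : ℤ) : combPoint n < 1 := by
  unfold combPoint
  rw [div_lt_one (by positivity)]
  linarith

theorem combPoint_strictMono : StrictMono combPoint := by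
  intro m n hmn
  unfold combPoint
  rw [div_lt_div_iff₀ (by positivity) (by positivity)]
  have : (2 : ℝ) ^ m < 2 ^ n := zpow_lt_zpow_right₀ (by norm_num) hmn
  linarith

/-- One Möbius map, fixing `0` and `1`, advances the whole sequence by a step; this realizes the
shift on combs. -/
theorem combPoint_succ (n : ℤ) : combPoint (n + 1) = 2 * combPoint n / (1 + combPoint n) := by
  unfold combPoint
  have h : (0 : ℝ) < 2 ^ n := by positivity
  rw [zpow_add_one₀ (by norm_num)]
  field_simp
  ring

theorem combPoint_mul_le (n : ℤ) : combPoint n * (1 - combPoint n) ≤ 2 ^ n := by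
  have h : (0 : ℝ) < 2 ^ n := by positivity
  have h1 : combPoint n ≤ 2 ^ n := by
    unfold combPoint
    exact div_le_self h.le (by linarith)
  have := combPoint_pos n
  nlinarith

theorem combPoint_mul_le_neg (n : ℤ) : combPoint n * (1 - combPoint n) ≤ 2 ^ (-n) := by
  have h : (0 : ℝ) < 2 ^ n := by positivity
  have h1 : 1 - combPoint n ≤ 2 ^ (-n) := by
    unfold combPoint
    rw [zpow_neg, one_sub_div (by positivity), ← one_div, div_le_div_iff₀ (by positivity) h]
    linarith
  have := combPoint_pos n
  have := combPoint_lt_one n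
  nlinarith

theorem finite_setOf_le_combPoint_mul {ε : ℝ} (hε : 0 < ε) :
    {n | ε ≤ combPoint n * (1 - combPoint n)}.Finite := by
  obtain ⟨N, hN⟩ := exists_pow_lt_of_lt_one hε (show (1 / 2 : ℝ) < 1 by norm_num)
  have hN' : (2 : ℝ) ^ (-(N : ℤ)) < ε := by simpa using hN
  refine (finite_Icc (-(N : ℤ)) N).subset fun n hn => ⟨?_, ?_⟩
  · by_contra! h
    have : (2 : ℝ) ^ n ≤ 2 ^ (-(N : ℤ)) := zpow_le_zpow_right₀ (by norm_num) h.le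
    linarith [combPoint_mul_le n, show ε ≤ _ from hn]
  · by_contra! h
    have : (2 : ℝ) ^ (-n) ≤ 2 ^ (-(N : ℤ)) := zpow_le_zpow_right₀ (by norm_num) (by omega)
    linarith [combPoint_mul_le_neg n, show ε ≤ _ from hn]

/-- The unit interval with vertical arcs attached at the points `combPoint n`: one going up if
`u n`, and one going down if `l n`. -/
def comb (u l : ℤ → Bool) : Set (ℝ × ℝ) :=
  {p | p.1 ∈ Icc 0 1 ∧ |p.2| ≤ p.1 * (1 - p.1) ∧
    (p.2 = 0 ∨ ∃ n, p.1 = combPoint n ∧ (0 ≤ p.2 ∧ u n = true ∨ p.2 ≤ 0 ∧ l n = true))}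

section comb

variable {u l : ℤ → Bool}

theorem isClosed_setOf_mem_comb :
    IsClosed {q : ((ℤ → Bool) × (ℤ → Bool)) × (ℝ × ℝ) | q.2 ∈ comb q.1.1 q.1.2} := by
  -- Only finitely many arcs have height at least `ε`, so at each scale the arc condition is a
  -- finite union of closed ones.
  have key : {q : ((ℤ → Bool) × (ℤ → Bool)) × (ℝ × ℝ) | q.2 ∈ comb q.1.1 q.1.2} =
      {q | q.2.1 ∈ Icc 0 1} ∩ ({q | |q.2.2| ≤ q.2.1 * (1 - q.2.1)} ∩
      ⋂ ε : Ioi (0 : ℝ), ({q | |q.2.2| ≤ (ε : ℝ)} ∪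
        ⋃ n ∈ {n | (ε : ℝ) ≤ combPoint n * (1 - combPoint n)}, {q | q.2.1 = combPoint n ∧
          (0 ≤ q.2.2 ∧ q.1.1 n = true ∨ q.2.2 ≤ 0 ∧ q.1.2 n = true)})) := by
    ext ⟨⟨u, l⟩, t, s⟩
    simp only [comb, mem_ofPred_eq, mem_inter_iff, mem_iInter, mem_union, mem_iUnion, exists_prop,
      Subtype.forall, mem_Ioi]
    refine and_congr_right fun ht => and_congr_right fun hs => ⟨?_, ?_⟩
    · rintro (rfl | ⟨n, rfl, hn⟩) ε hε
      · left
        simpa using hε.le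
      · rcases le_total |s| ε with h | h
        · exact Or.inl h
        · exact Or.inr ⟨n, h.trans hs, rfl, hn⟩
    · intro h
      by_contra! hne
      have hpos : 0 < |s| := abs_pos.2 hne.1
      rcases h (|s| / 2) (by positivity) with h | ⟨n, -, h1, h2⟩
      · linarith
      · have h3 := hne.2 n h1
        tauto
  rw [key]
  refine (isClosed_Icc.preimage (by fun_prop)).inter ((isClosed_le (by fun_prop)
    (by fun_prop)).inter (isClosed_iInter fun ε => (isClosed_le (by fun_prop)
    (by fun_prop)).union ((finite_setOf_le_combPoint_mul ε.2).isClosed_biUnion fun n _ => ?_)))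
  refine (isClosed_eq (f := fun q : ((ℤ → Bool) × (ℤ → Bool)) × (ℝ × ℝ) => q.2.1)
    (by fun_prop) (by fun_prop)).inter (IsClosed.union ?_ ?_)
  · exact (isClosed_le (f := fun _ => (0 : ℝ))
      (g := fun q : ((ℤ → Bool) × (ℤ → Bool)) × (ℝ × ℝ) => q.2.2) (by fun_prop)
      (by fun_prop)).inter (isClosed_eq
      (f := fun q : ((ℤ → Bool) × (ℤ → Bool)) × (ℝ × ℝ) => q.1.1 n) (by fun_prop) (by fun_prop))
  · exact (isClosed_le (g := fun _ => (0 : ℝ))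
      (f := fun q : ((ℤ → Bool) × (ℤ → Bool)) × (ℝ × ℝ) => q.2.2) (by fun_prop)
      (by fun_prop)).inter (isClosed_eq
      (f := fun q : ((ℤ → Bool) × (ℤ → Bool)) × (ℝ × ℝ) => q.1.2 n) (by fun_prop) (by fun_prop))

theorem isClosed_comb : IsClosed (comb u l) :=
  isClosed_setOf_mem_comb.preimage (f := fun p : ℝ × ℝ => ((u, l), p)) (by fun_prop)

theorem isCompact_comb : IsCompact (comb u l) := by
  refine ((isCompact_Icc (a := (0 : ℝ)) (b := 1)).prod (isCompact_Icc (a := (-1 : ℝ)) (b := 1)))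
    |>.of_isClosed_subset isClosed_comb ?_
  rintro ⟨t, s⟩ ⟨ht, hs, -⟩
  refine ⟨ht, abs_le.1 (hs.trans ?_)⟩
  nlinarith [ht.1, ht.2]

theorem mk_zero_mem_comb {t : ℝ} (ht : t ∈ Icc (0 : ℝ) 1) : (t, 0) ∈ comb u l :=
  ⟨ht, by simpa using mul_nonneg ht.1 (sub_nonneg.2 ht.2), Or.inl rfl⟩

theorem combPoint_mem_comb (n : ℤ) : (combPoint n, 0) ∈ comb u l :=
  mk_zero_mem_comb ⟨(combPoint_pos n).le, (combPoint_lt_one n).le⟩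

theorem mk_mem_comb_of_mem_uIcc {t s v : ℝ} (h : (t, v) ∈ comb u l) (hs : s ∈ uIcc 0 v) :
    (t, s) ∈ comb u l := by
  obtain ⟨h1, h2, h3⟩ := h
  dsimp only at h1 h2 h3
  have hle : |s| ≤ |v| := by
    simpa using abs_sub_left_of_mem_uIcc hs
  refine ⟨h1, hle.trans h2, ?_⟩
  rcases h3 with rfl | ⟨n, hn, h⟩
  · left
    simpa using hs
  · refine Or.inr ⟨n, hn, ?_⟩
    rcases h with ⟨h, hu⟩ | ⟨h, hl⟩
    · rw [uIcc_of_le h] at hs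
      exact Or.inl ⟨hs.1, hu⟩
    · rw [uIcc_of_ge h] at hs
      exact Or.inr ⟨hs.2, hl⟩

/-- A plane set whose vertical fibres are segments containing a point of an interval on the
horizontal axis is connected. -/
theorem isPreconnected_of_uIcc_subset {S : Set (ℝ × ℝ)} {J : Set ℝ} (hJ : IsPreconnected J)
    (h0 : ∀ t ∈ J, (t, 0) ∈ S) (hS : ∀ p ∈ S, p.1 ∈ J)
    (hfib : ∀ p ∈ S, ∀ s ∈ uIcc 0 p.2, (p.1, s) ∈ S) : IsPreconnected S := by
  rcases J.eq_empty_or_nonempty with rfl | ⟨t₀, ht₀⟩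
  · rw [eq_empty_of_forall_notMem hS]
    exact isPreconnected_empty
  refine isPreconnected_of_forall (t₀, 0) fun p hp =>
    ⟨(J ×ˢ {0}) ∪ ({p.1} ×ˢ uIcc 0 p.2), ?_, Or.inl ⟨ht₀, rfl⟩, Or.inr ⟨rfl, right_mem_uIcc⟩, ?_⟩
  · rintro ⟨t, s⟩ (⟨ht, rfl⟩ | ⟨rfl, hs⟩)
    · exact h0 t ht
    · exact hfib p hp s hs
  · exact (hJ.prod isPreconnected_singleton).union (p.1, 0) ⟨hS p hp, rfl⟩ ⟨rfl, left_mem_uIcc⟩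
      (isPreconnected_singleton.prod isPreconnected_uIcc)

theorem isPreconnected_comb : IsPreconnected (comb u l) :=
  isPreconnected_of_uIcc_subset isPreconnected_Icc (fun _ ht => mk_zero_mem_comb ht)
    (fun _ hp => hp.1) fun _ hp _ hs => mk_mem_comb_of_mem_uIcc hp hs

theorem comb_mono {u' l' : ℤ → Bool} (hu : ∀ n, u n = true → u' n = true)
    (hl : ∀ n, l n = true → l' n = true) : comb u l ⊆ comb u' l' := by
  rintro p ⟨h1, h2, h3⟩
  refine ⟨h1, h2, h3.imp_right ?_⟩
  rintro ⟨n, hn, h⟩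
  exact ⟨n, hn, h.imp (And.imp_right (hu n)) (And.imp_right (hl n))⟩

/-- Apply `t ↦ 2t / (1 + t)` horizontally and scale vertically by its derivative: this respects the
height bound `t * (1 - t)` exactly. -/
theorem comb_homeomorph_comb_comp_succ (u l : ℤ → Bool) :
    Nonempty (comb (fun n => u (n + 1)) (fun n => l (n + 1)) ≃ₜ comb u l) := by
  have hf : ∀ p : comb (fun n => u (n + 1)) (fun n => l (n + 1)),
      ((2 * p.1.1 / (1 + p.1.1), 2 * p.1.2 / (1 + p.1.1) ^ 2) : ℝ × ℝ) ∈ comb u l := by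
    rintro ⟨⟨t, s⟩, ⟨h0, h1⟩, h2, h3⟩
    dsimp only at h0 h1 h2 h3 ⊢
    refine ⟨⟨by positivity, ?_⟩, ?_, ?_⟩
    · rw [div_le_one (by positivity)]
      linarith
    · dsimp only
      rw [abs_div, abs_mul, abs_of_pos (show (0 : ℝ) < (1 + t) ^ 2 by positivity),
        show 2 * t / (1 + t) * (1 - 2 * t / (1 + t)) = 2 * (t * (1 - t)) / (1 + t) ^ 2 by
          field_simp; ring, abs_of_pos (show (0 : ℝ) < 2 by norm_num)]
      gcongr
    · dsimp only
      rcases h3 with rfl | ⟨n, rfl, h⟩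
      · left
        simp
      · refine Or.inr ⟨n + 1, (combPoint_succ n).symm, h.imp ?_ ?_⟩
        · rintro ⟨h, hu⟩
          exact ⟨by positivity, hu⟩
        · rintro ⟨h, hl⟩
          exact ⟨div_nonpos_of_nonpos_of_nonneg (by linarith) (by positivity), hl⟩
  have hg : ∀ p : comb u l, ((p.1.1 / (2 - p.1.1), 2 * p.1.2 / (2 - p.1.1) ^ 2) : ℝ × ℝ) ∈
      comb (fun n => u (n + 1)) (fun n => l (n + 1)) := by
    rintro ⟨⟨t, s⟩, ⟨h0, h1⟩, h2, h3⟩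
    dsimp only at h0 h1 h2 h3 ⊢
    have ht : 0 < 2 - t := by linarith
    refine ⟨⟨by positivity, ?_⟩, ?_, ?_⟩
    · rw [div_le_one (by positivity)]
      linarith
    · dsimp only
      rw [abs_div, abs_mul, abs_of_pos (show (0 : ℝ) < (2 - t) ^ 2 by positivity),
        show t / (2 - t) * (1 - t / (2 - t)) = 2 * (t * (1 - t)) / (2 - t) ^ 2 by
          field_simp; ring, abs_of_pos (show (0 : ℝ) < 2 by norm_num)]
      gcongr
    · dsimp only
      rcases h3 with rfl | ⟨n, rfl, h⟩
      · left
        simp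
      · refine Or.inr ⟨n - 1, ?_, ?_⟩
        · have h4 := combPoint_succ (n - 1)
          have h5 := combPoint_pos (n - 1)
          rw [sub_add_cancel] at h4
          rw [h4]
          field_simp
          ring
        · rw [sub_add_cancel]
          refine h.imp ?_ ?_
          · rintro ⟨h, hu⟩
            exact ⟨by positivity, hu⟩
          · rintro ⟨h, hl⟩
            exact ⟨div_nonpos_of_nonpos_of_nonneg (by linarith) (by positivity), hl⟩
  refine ⟨⟨⟨fun p => ⟨_, hf p⟩, fun p => ⟨_, hg p⟩, ?_, ?_⟩, ?_, ?_⟩⟩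
  · rintro ⟨⟨t, s⟩, ⟨h0, h1⟩, h2, h3⟩
    dsimp only at h0 h1
    have h4 : 1 + t ≠ 0 := by positivity
    have h5 : 2 - 2 * t / (1 + t) = 2 / (1 + t) := by
      field_simp
      ring
    refine Subtype.ext (Prod.ext ?_ ?_)
    · dsimp only
      rw [h5]
      field_simp
    · dsimp only
      rw [h5]
      field_simp
  · rintro ⟨⟨t, s⟩, ⟨h0, h1⟩, h2, h3⟩
    dsimp only at h0 h1
    have h4 : 2 - t ≠ 0 := by linarith
    have h5 : 1 + t / (2 - t) = 2 / (2 - t) := by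
      field_simp
      ring
    refine Subtype.ext (Prod.ext ?_ ?_)
    · dsimp only
      rw [h5]
      field_simp
    · dsimp only
      rw [h5]
      field_simp
  · have h4 : ∀ p : comb (fun n => u (n + 1)) (fun n => l (n + 1)), 1 + p.1.1 ≠ 0 := fun p => by
      have := p.2.1.1
      positivity
    refine Continuous.subtype_mk (Continuous.prodMk (Continuous.div (by fun_prop) (by fun_prop) h4)
      (Continuous.div (by fun_prop) (by fun_prop) fun p => pow_ne_zero 2 (h4 p))) _
  · have h4 : ∀ p : comb u l, 2 - p.1.1 ≠ 0 := fun p => by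
      have := p.2.1.2
      linarith
    refine Continuous.subtype_mk (Continuous.prodMk (Continuous.div (by fun_prop) (by fun_prop) h4)
      (Continuous.div (by fun_prop) (by fun_prop) fun p => pow_ne_zero 2 (h4 p))) _

/-- Collapsing the arcs that a smaller comb lacks retracts the larger comb onto it. -/
theorem exists_retraction_comb (l : ℤ → Bool) :
    ∃ r : ℝ × ℝ → ℝ × ℝ, ContinuousOn r (comb (fun _ => true) fun _ => true) ∧
      MapsTo r (comb (fun _ => true) fun _ => true) (comb (fun _ => true) l) ∧
      EqOn r id (comb (fun _ => true) l) := by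
  classical
  -- The full comb is a union of two closed combs meeting only on the axis; the identity and the
  -- vertical projection glue along it.
  have hunion : comb (fun _ => true) (fun _ => true) =
      comb (fun _ => true) l ∪ comb (fun _ => false) (fun n => !l n) := by
    refine Subset.antisymm ?_ (union_subset (comb_mono (by simp) (by simp))
      (comb_mono (by simp) (by simp)))
    rintro p ⟨h1, h2, h3⟩
    rcases h3 with h | ⟨n, hn, h⟩
    · exact Or.inl ⟨h1, h2, Or.inl h⟩
    · rcases h with ⟨h, -⟩ | ⟨h, -⟩
      · exact Or.inl ⟨h1, h2, Or.inr ⟨n, hn, Or.inl ⟨h, rfl⟩⟩⟩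
      · rcases hl : l n with _ | _
        · exact Or.inr ⟨h1, h2, Or.inr ⟨n, hn, Or.inr ⟨h, by simp [hl]⟩⟩⟩
        · exact Or.inl ⟨h1, h2, Or.inr ⟨n, hn, Or.inr ⟨h, hl⟩⟩⟩
  have hinter : ∀ p ∈ comb (fun _ => true) l, p ∈ comb (fun _ => false) (fun n => !l n) →
      p.2 = 0 := by
    rintro p ⟨-, -, h3⟩ ⟨-, -, h4⟩
    rcases h3 with h | ⟨n, hn, h⟩
    · exact h
    rcases h4 with h4 | ⟨m, hm, h4⟩
    · exact h4
    obtain rfl : n = m := combPoint_strictMono.injective (hn.symm.trans hm)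
    simp only [Bool.false_eq_true, and_false, false_or, Bool.not_eq_true'] at h4
    rw [h4.2] at h
    simp only [and_true, Bool.false_eq_true, and_false, or_false] at h
    exact le_antisymm h4.1 h
  let r : ℝ × ℝ → ℝ × ℝ := fun p => if p ∈ comb (fun _ => true) l then p else (p.1, 0)
  have h1 : EqOn r id (comb (fun _ => true) l) := fun p hp => if_pos hp
  have h2 : EqOn r (fun p => (p.1, 0)) (comb (fun _ => false) (fun n => !l n)) := by
    intro p hp
    by_cases h : p ∈ comb (fun _ => true) l
    · rw [h1 h]
      exact Prod.ext rfl (hinter p h hp)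
    · exact if_neg h
  refine ⟨r, ?_, ?_, h1⟩
  · rw [hunion]
    exact ContinuousOn.union_of_isClosed (continuousOn_id.congr h1)
      (ContinuousOn.congr (by fun_prop) h2) isClosed_comb isClosed_comb
  · intro p hp
    by_cases h : p ∈ comb (fun _ => true) l
    · rw [h1 h]
      exact h
    · rw [show r p = (p.1, 0) from if_neg h]
      exact mk_zero_mem_comb hp.1

end comb

/-! ### Separation and the order of a point -/

/-- Every connected set containing `q` and `r` contains `p`. -/
def Separates {C : Type*} [TopologicalSpace C] (p q r : C) : Prop :=
  ∀ S : Set C, IsPreconnected S → q ∈ S → r ∈ S → p ∈ S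

/-- There are `m` points other than `p` that `p` separates pairwise. -/
def HasOrderAtLeast {C : Type*} [TopologicalSpace C] (m : ℕ) (p : C) : Prop :=
  ∃ q : Fin m → C, (∀ i, q i ≠ p) ∧ Pairwise fun i j => Separates p (q i) (q j)

section Separates

variable {C C' : Type*} [TopologicalSpace C] [TopologicalSpace C']

theorem Separates.map (h : C ≃ₜ C') {p q r : C} (hs : Separates p q r) :
    Separates (h p) (h q) (h r) := by
  intro S hS hq hr
  exact hs (h ⁻¹' S) (h.isPreconnected_preimage.2 hS) hq hr

theorem separates_map_iff (h : C ≃ₜ C') {p q r : C} :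
    Separates (h p) (h q) (h r) ↔ Separates p q r :=
  ⟨fun hs => by simpa using hs.map h.symm, fun hs => hs.map h⟩

theorem HasOrderAtLeast.map (h : C ≃ₜ C') {m : ℕ} {p : C} (hp : HasOrderAtLeast m p) :
    HasOrderAtLeast m (h p) := by
  obtain ⟨q, hq, hs⟩ := hp
  exact ⟨h ∘ q, fun i => h.injective.ne (hq i), fun i j hij => (hs hij).map h⟩

theorem hasOrderAtLeast_map_iff (h : C ≃ₜ C') {m : ℕ} {p : C} :
    HasOrderAtLeast m (h p) ↔ HasOrderAtLeast m p :=
  ⟨fun hp => by simpa using hp.map h.symm, fun hp => hp.map h⟩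

theorem not_separates_of_isPreconnected {D S : Set C} {p q r : D} (hSD : S ⊆ D)
    (hS : IsPreconnected S) (hp : (p : C) ∉ S) (hq : (q : C) ∈ S) (hr : (r : C) ∈ S) :
    ¬ Separates p q r := by
  intro h
  refine hp (h (Subtype.val ⁻¹' S) ?_ hq hr)
  rwa [← IsInducing.subtypeVal.isPreconnected_image, Subtype.image_preimage_coe,
    inter_eq_right.2 hSD]

/-- Pigeonhole: two of `k + 1` points share a connected piece that avoids `p`. -/
theorem not_hasOrderAtLeast_of_cover {D : Set C} {p : D} {k : ℕ} (T : Fin k → Set C)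
    (hTD : ∀ i, T i ⊆ D) (hT : ∀ i, IsPreconnected (T i)) (hp : ∀ i, (p : C) ∉ T i)
    (hcov : ∀ q ∈ D, q ≠ p → ∃ i, q ∈ T i) : ¬ HasOrderAtLeast (k + 1) p := by
  rintro ⟨q, hq, hs⟩
  choose f hf using fun i => hcov (q i) (q i).2 (fun h => hq i (Subtype.ext h))
  obtain ⟨i, j, hij, hfij⟩ := Fintype.exists_ne_map_eq_of_card_lt f (by simp)
  exact not_separates_of_isPreconnected (hTD (f i)) (hT _) (hp _) (hf i) (hfij ▸ hf j) (hs hij)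

theorem separates_of_isOpen_cover {D : Set C} {p q r : D} {ι : Type*} (P : ι → Set C)
    (hP : ∀ i, IsOpen (P i)) (hdisj : ∀ z ∈ D, ∀ i j, z ∈ P i → z ∈ P j → i = j)
    (hcov : ∀ z ∈ D, z ≠ p → ∃ i, z ∈ P i) {i j : ι} (hij : i ≠ j) (hq : (q : C) ∈ P i)
    (hr : (r : C) ∈ P j) : Separates p q r := by
  intro S hS hqS hrS
  by_contra hpS
  obtain ⟨z, -, hz, hz'⟩ := hS (Subtype.val ⁻¹' P i) (Subtype.val ⁻¹' ⋃ l ∈ {l | l ≠ i}, P l)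
    ((hP i).preimage continuous_subtype_val)
    ((isOpen_biUnion fun l _ => hP l).preimage continuous_subtype_val)
    (by
      intro z hz
      obtain ⟨l, hl⟩ := hcov z z.2 (fun h => hpS (Subtype.ext h ▸ hz))
      by_cases hli : l = i
      · exact Or.inl (hli ▸ hl)
      · exact Or.inr (mem_biUnion (x := l) hli hl))
    ⟨q, hqS, hq⟩ ⟨r, hrS, mem_biUnion (x := j) hij.symm hr⟩
  obtain ⟨l, hl, hzl⟩ := mem_iUnion₂.1 hz'
  exact hl (hdisj z z.2 l i hzl hz)

end Separates

/-! ### Branch points of combs -/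

section comb

variable {u l : ℤ → Bool}

theorem isPreconnected_comb_inter_preimage {J : Set ℝ} (hJ : J.OrdConnected) :
    IsPreconnected (comb u l ∩ Prod.fst ⁻¹' J) :=
  isPreconnected_of_uIcc_subset (J := Icc 0 1 ∩ J) (ordConnected_Icc.inter hJ).isPreconnected
    (fun _ ht => ⟨mk_zero_mem_comb ht.1, ht.2⟩) (fun _ hp => ⟨hp.1.1, hp.2⟩)
    fun _ hp _ hs => ⟨mk_mem_comb_of_mem_uIcc hp.1 hs, hp.2⟩

theorem exists_combPoint_eq_of_mem_comb {p : ℝ × ℝ} (hp : p ∈ comb u l) (h : p.2 ≠ 0) :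
    ∃ n, p.1 = combPoint n := by
  obtain ⟨-, -, h3⟩ := hp
  rcases h3 with h3 | ⟨n, hn, -⟩
  · exact absurd h3 h
  · exact ⟨n, hn⟩

theorem isPreconnected_comb_inter_fibre (t : ℝ) {I : Set ℝ} (hI : I.OrdConnected)
    (hI0 : (∀ v ∈ I, 0 ≤ v) ∨ ∀ v ∈ I, v ≤ 0) : IsPreconnected (comb u l ∩ {t} ×ˢ I) := by
  have h : comb u l ∩ {t} ×ˢ I = {t} ×ˢ {v | (t, v) ∈ comb u l ∧ v ∈ I} := by
    ext ⟨t', v⟩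
    simp only [mem_inter_iff, mem_prod, mem_singleton_iff, mem_ofPred_eq]
    constructor
    · rintro ⟨h1, rfl, h2⟩
      exact ⟨rfl, h1, h2⟩
    · rintro ⟨rfl, h1, h2⟩
      exact ⟨h1, rfl, h2⟩
  rw [h]
  refine isPreconnected_singleton.prod (OrdConnected.isPreconnected ⟨?_⟩)
  rintro v ⟨hv, hvI⟩ w ⟨hw, hwI⟩ z ⟨hz1, hz2⟩
  refine ⟨?_, hI.out hvI hwI ⟨hz1, hz2⟩⟩
  rcases hI0 with h0 | h0
  · exact mk_mem_comb_of_mem_uIcc hw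
      (by rw [uIcc_of_le (h0 w hwI)]; exact ⟨(h0 v hvI).trans hz1, hz2⟩)
  · exact mk_mem_comb_of_mem_uIcc hv
      (by rw [uIcc_of_ge (h0 v hvI)]; exact ⟨hz1, hz2.trans (h0 w hwI)⟩)

/-- The four open pieces into which the point `(combPoint n, 0)` cuts a comb. -/
def combPiece (n : ℤ) : Fin 4 → Set (ℝ × ℝ) :=
  ![{p | p.1 < combPoint n}, {p | combPoint n < p.1},
    {p | p.1 ∈ Ioo (combPoint (n - 1)) (combPoint (n + 1)) ∧ 0 < p.2},
    {p | p.1 ∈ Ioo (combPoint (n - 1)) (combPoint (n + 1)) ∧ p.2 < 0}]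

theorem isOpen_combPiece (n : ℤ) (i : Fin 4) : IsOpen (combPiece n i) := by
  fin_cases i
  · exact isOpen_lt (by fun_prop) (by fun_prop)
  · exact isOpen_lt (by fun_prop) (by fun_prop)
  · exact (isOpen_Ioo.preimage continuous_fst).inter
      (isOpen_lt (f := fun _ : ℝ × ℝ => (0 : ℝ)) (by fun_prop) (by fun_prop))
  · exact (isOpen_Ioo.preimage continuous_fst).inter
      (isOpen_lt (g := fun _ : ℝ × ℝ => (0 : ℝ)) (by fun_prop) (by fun_prop))

theorem separates_of_mem_combPiece {n : ℤ} {q r : comb u l} {i j : Fin 4} (hij : i ≠ j)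
    (hq : (q : ℝ × ℝ) ∈ combPiece n i) (hr : (r : ℝ × ℝ) ∈ combPiece n j) :
    Separates (⟨_, combPoint_mem_comb n⟩ : comb u l) q r := by
  refine separates_of_isOpen_cover (combPiece n) (isOpen_combPiece n) ?_ ?_ hij hq hr
  · have key : ∀ z ∈ comb u l, z.2 ≠ 0 → z.1 ∈ Ioo (combPoint (n - 1)) (combPoint (n + 1)) →
        z.1 = combPoint n := by
      intro z hz h0 h
      obtain ⟨m, hm⟩ := exists_combPoint_eq_of_mem_comb hz h0
      rw [hm] at h ⊢
      have h1 := combPoint_strictMono.lt_iff_lt.1 h.1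
      have h2 := combPoint_strictMono.lt_iff_lt.1 h.2
      congr 1
      omega
    have key1 : ∀ z ∈ comb u l, z ∈ combPiece n 2 → z.1 = combPoint n := fun z hz h =>
      key z hz (ne_of_gt h.2) h.1
    have key2 : ∀ z ∈ comb u l, z ∈ combPiece n 3 → z.1 = combPoint n := fun z hz h =>
      key z hz (ne_of_lt h.2) h.1
    intro z hz i j hi hj
    have k1 := key1 z hz
    have k2 := key2 z hz
    fin_cases i <;> fin_cases j <;> simp [combPiece] at hi hj k1 k2 ⊢ <;> grind
  · rintro ⟨t, s⟩ hz hne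
    have h1 := combPoint_strictMono (show n - 1 < n by omega)
    have h2 := combPoint_strictMono (show n < n + 1 by omega)
    rcases lt_trichotomy t (combPoint n) with h | rfl | h
    · exact ⟨0, h⟩
    · rcases lt_trichotomy s 0 with h | rfl | h
      · exact ⟨3, ⟨h1, h2⟩, h⟩
      · exact absurd rfl hne
      · exact ⟨2, ⟨h1, h2⟩, h⟩
    · exact ⟨1, h⟩

theorem separates_combPoint_iff {m n k : ℤ} (hn : n ≠ m) (hk : k ≠ m) :
    Separates (⟨_, combPoint_mem_comb m⟩ : comb u l) ⟨_, combPoint_mem_comb n⟩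
      ⟨_, combPoint_mem_comb k⟩ ↔ n < m ∧ m < k ∨ k < m ∧ m < n := by
  constructor
  · contrapose
    intro h
    rcases lt_or_gt_of_ne hn with hn | hn
    · have hk : k < m := by omega
      exact not_separates_of_isPreconnected inter_subset_left
        (isPreconnected_comb_inter_preimage ordConnected_Iio) (fun h => lt_irrefl (combPoint m) h.2)
        ⟨combPoint_mem_comb n, combPoint_strictMono hn⟩
        ⟨combPoint_mem_comb k, combPoint_strictMono hk⟩
    · have hk : m < k := by omega
      exact not_separates_of_isPreconnected inter_subset_left
        (isPreconnected_comb_inter_preimage ordConnected_Ioi) (fun h => lt_irrefl (combPoint m) h.2)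
        ⟨combPoint_mem_comb n, combPoint_strictMono hn⟩
        ⟨combPoint_mem_comb k, combPoint_strictMono hk⟩
  · rintro (⟨h1, h2⟩ | ⟨h1, h2⟩)
    · exact separates_of_mem_combPiece (i := 0) (j := 1) (by decide) (combPoint_strictMono h1)
        (combPoint_strictMono h2)
    · exact separates_of_mem_combPiece (i := 1) (j := 0) (by decide) (combPoint_strictMono h2)
        (combPoint_strictMono h1)

theorem hasOrderAtLeast_combPoint_of_mem {n : ℤ} {m : ℕ} (hm : m ≤ 4) (q : Fin m → comb u l)
    (hq : ∀ i, (q i : ℝ × ℝ) ∈ combPiece n (Fin.castLE hm i)) :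
    HasOrderAtLeast m (⟨_, combPoint_mem_comb n⟩ : comb u l) := by
  refine ⟨q, fun i hi => ?_, fun i j hij => separates_of_mem_combPiece
    ((Fin.castLE_injective hm).ne hij) (hq i) (hq j)⟩
  have h : ∀ k, (combPoint n, (0 : ℝ)) ∉ combPiece n k := by
    intro k
    fin_cases k <;> simp [combPiece]
  have := hq i
  rw [hi] at this
  exact h _ this

theorem combPoint_mem_Ioo (n : ℤ) :
    combPoint n ∈ Ioo (combPoint (n - 1)) (combPoint (n + 1)) :=
  ⟨combPoint_strictMono (by omega), combPoint_strictMono (by omega)⟩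

theorem combPoint_mul_pos (n : ℤ) : 0 < combPoint n * (1 - combPoint n) :=
  mul_pos (combPoint_pos n) (sub_pos.2 (combPoint_lt_one n))

theorem mk_top_mem_comb {n : ℤ} (hu : u n = true) :
    (combPoint n, combPoint n * (1 - combPoint n)) ∈ comb u l :=
  ⟨⟨(combPoint_pos n).le, (combPoint_lt_one n).le⟩, (abs_of_pos (combPoint_mul_pos n)).le,
    Or.inr ⟨n, rfl, Or.inl ⟨(combPoint_mul_pos n).le, hu⟩⟩⟩

theorem mk_bottom_mem_comb {n : ℤ} (hl : l n = true) :
    (combPoint n, -(combPoint n * (1 - combPoint n))) ∈ comb u l :=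
  ⟨⟨(combPoint_pos n).le, (combPoint_lt_one n).le⟩,
    (abs_neg _).trans_le (abs_of_pos (combPoint_mul_pos n)).le,
    Or.inr ⟨n, rfl, Or.inr ⟨neg_nonpos.2 (combPoint_mul_pos n).le, hl⟩⟩⟩

theorem hasOrderAtLeast_three_combPoint {n : ℤ} (hu : u n = true) :
    HasOrderAtLeast 3 (⟨_, combPoint_mem_comb n⟩ : comb u l) := by
  refine hasOrderAtLeast_combPoint_of_mem (by norm_num)
    ![⟨(0, 0), mk_zero_mem_comb (by simp)⟩, ⟨(1, 0), mk_zero_mem_comb (by simp)⟩,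
      ⟨_, mk_top_mem_comb hu⟩] fun i => ?_
  fin_cases i
  · exact combPoint_pos n
  · exact combPoint_lt_one n
  · exact ⟨combPoint_mem_Ioo n, combPoint_mul_pos n⟩

theorem hasOrderAtLeast_four_combPoint_iff {n : ℤ} (hu : u n = true) :
    HasOrderAtLeast 4 (⟨_, combPoint_mem_comb n⟩ : comb u l) ↔ l n = true := by
  constructor
  · contrapose
    intro hl
    refine not_hasOrderAtLeast_of_cover ![comb u l ∩ Prod.fst ⁻¹' Iio (combPoint n),
      comb u l ∩ Prod.fst ⁻¹' Ioi (combPoint n), comb u l ∩ {combPoint n} ×ˢ Ioi 0] ?_ ?_ ?_ ?_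
    · intro i
      fin_cases i <;> exact inter_subset_left
    · intro i
      fin_cases i
      · exact isPreconnected_comb_inter_preimage ordConnected_Iio
      · exact isPreconnected_comb_inter_preimage ordConnected_Ioi
      · exact isPreconnected_comb_inter_fibre _ ordConnected_Ioi (Or.inl fun v hv => le_of_lt hv)
    · intro i
      fin_cases i <;> simp
    · rintro ⟨t, s⟩ hq hne
      rcases lt_trichotomy t (combPoint n) with h | rfl | h
      · exact ⟨0, hq, h⟩
      · refine ⟨2, hq, rfl, ?_⟩
        have hs : s ≠ 0 := fun h => hne (by rw [h])
        obtain ⟨-, -, h3⟩ := hq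
        rcases h3 with h3 | ⟨m, hm, h3⟩
        · exact absurd h3 hs
        · obtain rfl := combPoint_strictMono.injective hm
          rcases h3 with h3 | h3
          · exact lt_of_le_of_ne h3.1 hs.symm
          · exact absurd h3.2 hl
      · exact ⟨1, hq, h⟩
  · intro hl
    refine hasOrderAtLeast_combPoint_of_mem le_rfl
      ![⟨(0, 0), mk_zero_mem_comb (by simp)⟩, ⟨(1, 0), mk_zero_mem_comb (by simp)⟩,
        ⟨_, mk_top_mem_comb hu⟩, ⟨_, mk_bottom_mem_comb hl⟩] fun i => ?_
    fin_cases i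
    · exact combPoint_pos n
    · exact combPoint_lt_one n
    · exact ⟨combPoint_mem_Ioo n, combPoint_mul_pos n⟩
    · exact ⟨combPoint_mem_Ioo n, neg_neg_of_pos (combPoint_mul_pos n)⟩

/-- Removing any other point leaves at most two connected pieces: left and right on the axis, or the
outer part of an arc and the rest. -/
theorem exists_eq_combPoint_of_hasOrderAtLeast {p : comb u l} (hp : HasOrderAtLeast 3 p) :
    ∃ n, p = ⟨_, combPoint_mem_comb n⟩ := by
  obtain ⟨⟨t, s⟩, hts⟩ := p
  rcases eq_or_ne s 0 with rfl | hs
  · by_contra! hne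
    refine not_hasOrderAtLeast_of_cover ![comb u l ∩ Prod.fst ⁻¹' Iio t,
      comb u l ∩ Prod.fst ⁻¹' Ioi t] ?_ ?_ ?_ ?_ hp
    · intro i
      fin_cases i <;> exact inter_subset_left
    · intro i
      fin_cases i
      · exact isPreconnected_comb_inter_preimage ordConnected_Iio
      · exact isPreconnected_comb_inter_preimage ordConnected_Ioi
    · intro i
      fin_cases i <;> simp
    · rintro ⟨t', s'⟩ hq hne'
      rcases lt_trichotomy t' t with h | rfl | h
      · exact ⟨0, hq, h⟩
      · have hs' : s' ≠ 0 := fun h => hne' (by rw [h])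
        obtain ⟨n, rfl⟩ := exists_combPoint_eq_of_mem_comb hq hs'
        exact absurd rfl (hne n)
      · exact ⟨1, hq, h⟩
  · exfalso
    obtain ⟨I, hI, hI0, hsI, hIs⟩ : ∃ I : Set ℝ, I.OrdConnected ∧
        ((∀ v ∈ I, 0 ≤ v) ∨ ∀ v ∈ I, v ≤ 0) ∧ s ∉ I ∧ ∀ v, v ∈ I ↔ s ∈ uIcc 0 v ∧ v ≠ s := by
      rcases lt_or_gt_of_ne hs with h | h
      · refine ⟨Iio s, ordConnected_Iio, Or.inr fun v hv => (hv.trans h).le, by simp,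
          fun v => ⟨fun hv => ⟨?_, hv.ne⟩, ?_⟩⟩
        · rw [uIcc_of_ge (hv.trans h).le]
          exact ⟨le_of_lt hv, h.le⟩
        · rintro ⟨h1, h2⟩
          rcases mem_uIcc.1 h1 with h3 | h3
          · linarith
          · exact lt_of_le_of_ne h3.1 h2
      · refine ⟨Ioi s, ordConnected_Ioi, Or.inl fun v hv => (h.trans hv).le, by simp,
          fun v => ⟨fun hv => ⟨?_, ne_of_gt hv⟩, ?_⟩⟩
        · rw [uIcc_of_le (h.trans hv).le]
          exact ⟨h.le, le_of_lt hv⟩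
        · rintro ⟨h1, h2⟩
          rcases mem_uIcc.1 h1 with h3 | h3
          · exact lt_of_le_of_ne h3.2 h2.symm
          · linarith
    refine not_hasOrderAtLeast_of_cover ![comb u l ∩ {t} ×ˢ I,
      {q ∈ comb u l | ¬ (q.1 = t ∧ s ∈ uIcc 0 q.2)}] ?_ ?_ ?_ ?_ hp
    · intro i
      fin_cases i
      · exact inter_subset_left
      · exact sep_subset _ _
    · intro i
      fin_cases i
      · exact isPreconnected_comb_inter_fibre t hI hI0
      · refine isPreconnected_of_uIcc_subset isPreconnected_Icc
          (fun t' ht => ⟨mk_zero_mem_comb ht, ?_⟩) (fun q hq => hq.1.1)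
          fun q hq v hv => ⟨mk_mem_comb_of_mem_uIcc hq.1 hv, ?_⟩
        · rintro ⟨-, h⟩
          exact hs (by simpa using h)
        · rintro ⟨h1, h2⟩
          exact hq.2 ⟨h1, uIcc_subset_uIcc left_mem_uIcc hv h2⟩
    · intro i
      fin_cases i
      · exact fun h => hsI h.2.2
      · exact fun h => h.2 ⟨rfl, right_mem_uIcc⟩
    · rintro ⟨t', s'⟩ hq hne'
      by_cases h : t' = t ∧ s ∈ uIcc 0 s'
      · obtain ⟨rfl, h⟩ := h
        exact ⟨0, hq, rfl, (hIs s').2 ⟨h, fun h' => hne' (by rw [h'])⟩⟩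
      · exact ⟨1, hq, h⟩

end comb

/-! ### Rigidity: homeomorphism classes are countable -/

/-- An injection of `ℤ` moving consecutive integers to consecutive integers is affine. -/
theorem Int.eq_add_mul_of_injective {σ : ℤ → ℤ} (hσ : Function.Injective σ)
    (h : ∀ n, σ (n + 1) = σ n + 1 ∨ σ (n + 1) = σ n - 1) (n : ℤ) :
    σ n = σ 0 + n * (σ 1 - σ 0) := by
  -- Injectivity forbids turning back.
  have hstep : ∀ n, σ (n + 1 + 1) - σ (n + 1) = σ (n + 1) - σ n := by
    intro n
    have h1 := h n
    have h2 := h (n + 1)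
    have h3 : σ (n + 1 + 1) ≠ σ n := hσ.ne (by omega)
    omega
  have hdiff : ∀ n, σ (n + 1) - σ n = σ 1 - σ 0 := by
    intro n
    induction n using Int.induction_on with
    | zero => simp
    | succ n ih => rw [hstep, ih]
    | pred n ih =>
      rw [← ih]
      have := hstep (-(n : ℤ) - 1)
      rw [sub_add_cancel] at this ⊢
      exact this.symm
  induction n using Int.induction_on with
  | zero => simp
  | succ n ih =>
    have := hdiff n
    linarith
  | pred n ih =>
    have := hdiff (-(n : ℤ) - 1)
    rw [sub_add_cancel] at this
    linarith

theorem exists_eq_comp_of_comb_homeomorph {u x y : ℤ → Bool} (hu : ∀ n, u n = true)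
    (h : comb u x ≃ₜ comb u y) : ∃ c d : ℤ, x = fun n => y (c + n * d) := by
  choose σ hσ using fun n : ℤ => exists_eq_combPoint_of_hasOrderAtLeast
    ((hasOrderAtLeast_three_combPoint (l := x) (hu n)).map h)
  choose τ hτ using fun n : ℤ => exists_eq_combPoint_of_hasOrderAtLeast
    ((hasOrderAtLeast_three_combPoint (l := y) (hu n)).map h.symm)
  have hcomb : ∀ {l : ℤ → Bool} {m n : ℤ}, (⟨_, combPoint_mem_comb m⟩ : comb u l) =
      ⟨_, combPoint_mem_comb n⟩ → m = n := fun hmn =>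
    combPoint_strictMono.injective (congrArg (fun p => p.1.1) hmn)
  have hinj : Function.Injective σ := by
    intro m n hmn
    refine hcomb (h.injective ?_)
    rw [hσ, hσ]
    simp only [hmn]
  have hστ : ∀ n, σ (τ n) = n := by
    intro n
    refine hcomb (l := y) ?_
    rw [← hσ, ← hτ, h.apply_symm_apply]
  have hbetween : ∀ {m n k : ℤ}, n ≠ m → k ≠ m → (σ n < σ m ∧ σ m < σ k ∨
      σ k < σ m ∧ σ m < σ n ↔ n < m ∧ m < k ∨ k < m ∧ m < n) := by
    intro m n k hn hk
    rw [← separates_combPoint_iff (u := u) (l := x) hn hk, ← separates_map_iff h, hσ, hσ, hσ,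
      separates_combPoint_iff (hinj.ne hn) (hinj.ne hk)]
  -- Since `σ` is onto and reflects betweenness, no integer lies strictly between the images of
  -- consecutive ones.
  have hgap : ∀ n j, ¬ (σ n < j ∧ j < σ (n + 1) ∨ σ (n + 1) < j ∧ j < σ n) := by
    intro n j hj
    obtain ⟨i, rfl⟩ : ∃ i, σ i = j := ⟨τ j, hστ j⟩
    have h1 : n ≠ i := by
      rintro rfl
      omega
    have h2 : n + 1 ≠ i := by
      rintro rfl
      omega
    have := (hbetween h1 h2).1 hj
    omega
  have hstep : ∀ n, σ (n + 1) = σ n + 1 ∨ σ (n + 1) = σ n - 1 := by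
    intro n
    have h1 := hgap n (σ n + 1)
    have h2 := hgap n (σ n - 1)
    have h3 : σ (n + 1) ≠ σ n := hinj.ne (by omega)
    omega
  refine ⟨σ 0, σ 1 - σ 0, ?_⟩
  ext1 n
  rw [← Int.eq_add_mul_of_injective hinj hstep n, Bool.eq_iff_iff,
    ← hasOrderAtLeast_four_combPoint_iff (l := x) (hu n),
    ← hasOrderAtLeast_four_combPoint_iff (l := y) (hu (σ n)), ← hσ, hasOrderAtLeast_map_iff]

theorem countable_setOf_comb_homeomorph {u x : ℤ → Bool} (hu : ∀ n, u n = true) :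
    {y | Nonempty (comb u x ≃ₜ comb u y)}.Countable := by
  refine (countable_range fun c : ℤ × ℤ => fun n => x (c.1 + n * c.2)).mono ?_
  rintro y ⟨h⟩
  obtain ⟨c, d, rfl⟩ := exists_eq_comp_of_comb_homeomorph hu h.symm
  exact ⟨(c, d), rfl⟩

/-! ### The shift and its transitivity -/

/-- The shift on two-sided binary sequences. -/
def shiftHomeomorph : (ℤ → Bool) ≃ₜ (ℤ → Bool) where
  toFun x n := x (n + 1)
  invFun x n := x (n - 1)
  left_inv x := by ext1 n; simp
  right_inv x := by ext1 n; simp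
  continuous_toFun := by fun_prop
  continuous_invFun := by fun_prop

theorem shiftHomeomorph_iterate (k : ℕ) (x : ℤ → Bool) (n : ℤ) :
    shiftHomeomorph^[k] x n = x (n + k) := by
  induction k generalizing x with
  | zero => simp
  | succ k ih =>
    rw [Function.iterate_succ_apply, ih]
    change x (n + k + 1) = _
    congr 1
    push_cast
    ring

theorem exists_finset_forall_eq_imp_mem {ι : Type*} {α : ι → Type*} [∀ i, TopologicalSpace (α i)]
    {U : Set (∀ i, α i)} (hU : IsOpen U) {x : ∀ i, α i} (hx : x ∈ U) :
    ∃ s : Finset ι, ∀ y : ∀ i, α i, (∀ i ∈ s, y i = x i) → y ∈ U := by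
  obtain ⟨s, v, hv, hsub⟩ := isOpen_pi_iff.1 hU x hx
  exact ⟨s, fun y hy => hsub fun i hi => by rw [hy i hi]; exact (hv i hi).2⟩

theorem exists_iterate_shiftHomeomorph_inter_nonempty {U V : Set (ℤ → Bool)} (hU : IsOpen U)
    (hV : IsOpen V) (hU' : U.Nonempty) (hV' : V.Nonempty) :
    ∃ n : ℕ, (shiftHomeomorph^[n] ⁻¹' U ∩ V).Nonempty := by
  obtain ⟨x, hx⟩ := hU'
  obtain ⟨y, hy⟩ := hV'
  obtain ⟨s, hs⟩ := exists_finset_forall_eq_imp_mem hU hx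
  obtain ⟨t, ht⟩ := exists_finset_forall_eq_imp_mem hV hy
  obtain ⟨a, ha⟩ := s.bddBelow
  obtain ⟨b, hb⟩ := t.bddAbove
  -- Moved by `N`, the coordinates constrained by `U` lie beyond those constrained by `V`, so the
  -- two points can be spliced.
  obtain ⟨N, hN⟩ : ∃ N : ℕ, b < a + N := ⟨(b - a).toNat + 1, by omega⟩
  refine ⟨N, fun n => if n ≤ b then y n else x (n - N), hs _ fun i hi => ?_, ht _ fun i hi => ?_⟩
  · have := ha hi
    rw [shiftHomeomorph_iterate, if_neg (by omega), add_sub_cancel_right]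
  · exact if_pos (hb hi)

instance perfectSpace_pi_bool {ι : Type*} [Infinite ι] : PerfectSpace (ι → Bool) := by
  refine perfectSpace_iff_forall_not_isolated.2 fun x => ?_
  rw [← mem_closure_iff_nhdsWithin_neBot, mem_closure_iff]
  intro U hU hx
  obtain ⟨s, hs⟩ := exists_finset_forall_eq_imp_mem hU hx
  obtain ⟨i, hi⟩ := Infinite.exists_notMem_finset s
  classical
  refine ⟨Function.update x i (!x i), hs _ fun j hj => ?_, fun h => ?_⟩
  · rw [Function.update_of_ne]
    rintro rfl
    exact hi hj
  · have := congrFun h i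
    simp at this

/-! ### Application to the family of combs -/

theorem isContinuum_comb (u l : ℤ → Bool) : IsContinuum (comb u l) :=
  ⟨isCompact_iff_compactSpace.1 isCompact_comb, isConnected_iff_connectedSpace.1
    ⟨⟨_, combPoint_mem_comb 0⟩, isPreconnected_comb⟩, inferInstance⟩

theorem IsContinuum.of_homeomorph {C C' : Type*} [TopologicalSpace C] [TopologicalSpace C']
    (h : C ≃ₜ C') (hC : IsContinuum C) : IsContinuum C' := by
  obtain ⟨h1, h2, h3⟩ := hC
  exact ⟨h.compactSpace, h.surjective.connectedSpace h.continuous,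
    h.symm.isEmbedding.metrizableSpace⟩

theorem mainTheorem1 :
    ¬ UniquelyCompactifiable.{u, v}
      (fun (C : Type v) (_ : TopologicalSpace C) => IsContinuum C) := by
  rintro ⟨X, tX, hX, hXm, h⟩
  have : PolishSpace (ℤ → Bool) := { }
  let := metrizableSpaceMetric X
  let K := comb (fun _ => true) fun _ => true
  have : CompactSpace K := isCompact_iff_compactSpace.1 isCompact_comb
  let F : (ℤ → Bool) → Set K := fun x => Subtype.val ⁻¹' comb (fun _ => true) x
  have hsub : ∀ x, comb (fun _ => true) x ⊆ K := fun x => comb_mono (by simp) (by simp)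
  have himg : ∀ x, Subtype.val '' F x = comb (fun _ => true) x := fun x => by
    rw [Subtype.image_preimage_coe, inter_eq_right.2 (hsub x)]
  have e : ∀ x, F x ≃ₜ comb (fun _ => true) x := fun x =>
    (IsEmbedding.subtypeVal.homeomorphImage (F x)).trans (Homeomorph.setCongr (himg x))
  refine not_forall_existsUnique_component (X := X) (F := F)
    (k₀ := ⟨_, combPoint_mem_comb 0⟩) ?_ ?_ ?_ ?_ ?_ shiftHomeomorph
    (fun U V hU hV => exists_iterate_shiftHomeomorph_inter_nonempty hU hV) ?_ ?_ ?_
  · exact isClosed_setOf_mem_comb.preimage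
      (f := fun p : (ℤ → Bool) × K => ((fun _ => true, p.1), (p.2 : ℝ × ℝ))) (by fun_prop)
  · rintro ⟨p, hp⟩
    -- Membership of a fixed point depends on at most one coordinate of `x`, hence is open in `x`.
    have : {x | (⟨p, hp⟩ : K) ∈ F x} = {x | p.1 ∈ Icc 0 1 ∧ |p.2| ≤ p.1 * (1 - p.1) ∧ p.2 = 0} ∪
        ⋃ n : ℤ, {x | (p.1 ∈ Icc 0 1 ∧ |p.2| ≤ p.1 * (1 - p.1) ∧ p.1 = combPoint n) ∧
          (0 ≤ p.2 ∨ p.2 ≤ 0 ∧ x n = true)} := by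
      ext x
      simp only [F, comb, mem_preimage, mem_ofPred_eq, mem_union, mem_iUnion, and_true]
      constructor
      · rintro ⟨h1, h2, h3 | ⟨n, h3⟩⟩
        · exact Or.inl ⟨h1, h2, h3⟩
        · exact Or.inr ⟨n, ⟨h1, h2, h3.1⟩, h3.2⟩
      · rintro (⟨h1, h2, h3⟩ | ⟨n, ⟨h1, h2, h3⟩, h4⟩)
        · exact ⟨h1, h2, Or.inl h3⟩
        · exact ⟨h1, h2, Or.inr ⟨n, h3, h4⟩⟩
    rw [this]
    refine isOpen_const.union (isOpen_iUnion fun n => isOpen_const.and ?_)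
    have hn : IsOpen {x : ℤ → Bool | x n = true} :=
      (isOpen_discrete {true}).preimage (f := fun x : ℤ → Bool => x n) (by fun_prop)
    exact IsOpen.union (s₁ := {_x | 0 ≤ p.2}) isOpen_const (isOpen_const.and hn)
  · intro x
    rw [← IsInducing.subtypeVal.isPreconnected_image, himg]
    exact isPreconnected_comb
  · exact fun x => combPoint_mem_comb 0
  · intro x
    obtain ⟨r, hr, hmaps, hid⟩ := exists_retraction_comb x
    refine ⟨⟨fun k => ⟨⟨r k, hsub x (hmaps k.2)⟩, hmaps k.2⟩, ?_⟩, ?_⟩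
    · exact ((continuousOn_iff_continuous_domRestrict.1 hr).subtype_mk _).subtype_mk _
    · rintro ⟨k, hk⟩
      exact Subtype.ext (Subtype.ext (hid hk))
  · intro x
    obtain ⟨f⟩ := comb_homeomorph_comb_comp_succ (fun _ => true) x
    exact ⟨(e _).trans (f.trans (e x).symm)⟩
  · intro x
    refine (countable_setOf_comb_homeomorph (u := fun _ => true) (x := x) fun _ => rfl).mono ?_
    rintro y ⟨f⟩
    exact ⟨(e x).symm.trans (f.trans (e y))⟩
  · intro x
    -- `ULift` moves the comb into the universe of the given collection.
    let f : F x ≃ₜ ULift.{v} (comb (fun _ => true) x) := (e x).trans Homeomorph.ulift.symm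
    obtain ⟨D, ⟨hD, ⟨g⟩⟩, huniq⟩ := h (ULift.{v} (comb (fun _ => true) x)) inferInstance
      ((isContinuum_comb _ x).of_homeomorph Homeomorph.ulift.symm)
    refine ⟨D, ⟨hD, ⟨f.trans g⟩⟩, ?_⟩
    rintro D' ⟨hD', ⟨g'⟩⟩
    exact huniq D' ⟨hD', ⟨f.symm.trans g'⟩⟩
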